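/- For an integer $m\ge 3$ let $P_m(x)=\frac{(m-2)x^2-(m-4)x}{2}$. For a vector $\mathbf a=(a_1,\dots,a_k)$ of positive integers, the $m$-gonal form with coefficient vector $\mathbf a$ is $p_m(\mathbf a)(x_1,\dots,x_k)=a_1P_m(x_1)+\cdots+a_kP_m(x_k)$. Let $V'_m(\mathbf a)$ be the set of nonzero integers of the form $p_m(\mathbf a)(x_1,\dots,x_k)$ with $x_1,\dots,x_k\in\mathbb Z$. For a positive integer $n$ let $\mathcal T(n)$ be the set of all integers greater than or equal to $n$. The form $p_m(\mathbf a)$ is called tight $\mathcal T(n)$-universal if $V'_m(\mathbf a)=\mathcal T(n)$, and new tight $\mathcal T(n)$-universal if moreover $V'_m(\mathbf b)\subsetneq\mathcal T(n)$ for every proper subsequence $\mathbf b$ of $\mathbf a$ (the empty one included, with $V'_m(\mathbf b)=\varnothing$). Put $\mathbf x_n=(n,n,n+1,n+2,\dots,2n-1)$ and $\mathbf y_n=(n,n+1,n+2,\dots,2n)$. Theorem. Let $m\ge 8$ and $n\ge 2m-5$ be integers. Then, up to reordering of the coefficients, there are exactly two new tight $\mathcal T(n)$-universal $m$-gonal forms,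 namely $p_m(\mathbf x_n)$ and $p_m(\mathbf y_n)$. That is, for a finite vector $\mathbf a$ of positive integers, $p_m(\mathbf a)$ is new tight $\mathcal T(n)$-universal if and only if $\mathbf a$ is a permutation of $\mathbf x_n$ or of $\mathbf y_n$, and $\mathbf x_n$, $\mathbf y_n$ are not permutations of each other. -/

import Mathlib

/-- The polynomial `P_m(x) = ((m - 2) x² - (m - 4) x) / 2`; the numerator is always even, so the
integer division is exact. Its values at the integers are the generalized `m`-gonal numbers. -/
def polygonalNumber (m : ℕ) (x : ℤ) : ℤ :=
  (((m : ℤ) - 2) * x ^ 2 - ((m : ℤ) - 4) * x) / 2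

/-- The `m`-gonal form `p_m(a)(x₁, …, x_k) = a₁ P_m(x₁) + ⋯ + a_k P_m(x_k)` with coefficient
vector `a = (a₁, …, a_k)`. -/
def polygonalForm (m : ℕ) (a : List ℕ) (x : Fin a.length → ℤ) : ℤ :=
  ∑ i, (a.get i : ℤ) * polygonalNumber m (x i)

/-- The set of nonzero integers represented by the `m`-gonal form `p_m(a)`. -/
def representedSet (m : ℕ) (a : List ℕ) : Set ℤ :=
  {N | N ≠ 0 ∧ ∃ x : Fin a.length → ℤ, polygonalForm m a x = N}

/-- `T(n)`: the set of integers greater than or equal to `n`. -/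
def tailSet (n : ℕ) : Set ℤ :=
  {N | (n : ℤ) ≤ N}

/-- `p_m(a)`, with `a` a vector of positive integers, is tight `T(n)`-universal. -/
def IsTightUniversal (m n : ℕ) (a : List ℕ) : Prop :=
  (∀ c ∈ a, 0 < c) ∧ representedSet m a = tailSet n

/-- `p_m(a)` is new tight `T(n)`-universal: it is tight `T(n)`-universal, and every proper
subsequence `b` of `a` represents only a proper subset of `T(n)`. -/
def IsNewTightUniversal (m n : ℕ) (a : List ℕ) : Prop :=
  IsTightUniversal m n a ∧
    ∀ b : List ℕ, b.Sublist a → b ≠ a → representedSet m b ⊂ tailSet n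

/-- `x_n = (n, n, n + 1, n + 2, …, 2n - 1)`. -/
def xVec (n : ℕ) : List ℕ := n :: List.range' n n

/-- `y_n = (n, n + 1, n + 2, …, 2n)`. -/
def yVec (n : ℕ) : List ℕ := List.range' n (n + 1)

/-! ### Generalized polygonal numbers -/

/-! Necessity: for `m ≥ 8`, `P_m` takes only the values 0, 1 and integers at least 5. With all
coefficients at least `n`, a represented nonzero number below `3n` is therefore a coefficient or a
sum of two. So `n, …, 2n - 1` must all be coefficients, and `2n` is either a coefficient or `n + n`:
the form contains `y_n` or `x_n`.

Sufficiency: both vectors are `n, …, 2n - 1` with one extra entry `e ∈ {n, 2n}`. A symmetric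
substitution in the nine coefficients `n, …, n + 8` cancels the linear terms and leaves `G = (m -
2)(n + 4)` times a quaternary form representing every `k ≢ 1 (mod 3)`
(`represents_nine_consecutive`). By periodicity in `k`, the other coefficients need only handle a
window of length `3G` (`represents_of_window`). For `n ≥ 41` subset sums suffice; the finitely many
smaller pairs `(m, n)` are checked by computation on bit masks.

Both vectors have length `n + 1`, so neither has a proper tight subsequence. -/

theorem two_mul_polygonalNumber (m : ℕ) (x : ℤ) :
    2 * polygonalNumber m x = ((m : ℤ) - 2) * x ^ 2 - ((m : ℤ) - 4) * x := by
  unfold polygonalNumber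
  apply Int.mul_ediv_cancel'
  obtain ⟨t, ht⟩ := Int.even_mul_succ_self x
  -- The numerator is `(m - 2)(x² - x) + 2x`, and `x² + x = 2t`.
  exact ⟨((m : ℤ) - 2) * (t - x) + x, by linear_combination ((m : ℤ) - 2) * ht⟩

theorem polygonalNumber_zero (m : ℕ) : polygonalNumber m 0 = 0 := by
  have := two_mul_polygonalNumber m 0
  linarith

theorem polygonalNumber_one (m : ℕ) : polygonalNumber m 1 = 1 := by
  have := two_mul_polygonalNumber m 1
  linarith

/-- A generalized `m`-gonal number is `0`, `1` or at least `m - 3`. -/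
theorem polygonalNumber_trichotomy {m : ℕ} (hm : 4 ≤ m) (x : ℤ) :
    polygonalNumber m x = 0 ∨ polygonalNumber m x = 1 ∨ (m : ℤ) - 3 ≤ polygonalNumber m x := by
  have h := two_mul_polygonalNumber m x
  have hm' : (4 : ℤ) ≤ m := by exact_mod_cast hm
  rcases lt_trichotomy x 0 with hx | rfl | hx
  · right; right
    nlinarith [mul_nonneg (show (0 : ℤ) ≤ m - 2 by omega) (show 0 ≤ x ^ 2 - 1 by nlinarith),
      mul_nonneg (show (0 : ℤ) ≤ m - 4 by omega) (show 0 ≤ -x - 1 by omega)]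
  · left; linarith
  · rcases (show x = 1 ∨ 2 ≤ x by omega) with rfl | hx2
    · right; left; linarith
    · right; right
      nlinarith [mul_nonneg (show (0 : ℤ) ≤ m - 4 by omega)
        (mul_nonneg (show 0 ≤ x - 2 by omega) (show 0 ≤ x + 1 by omega))]

/-! ### Representations by a list of coefficients -/

/-- `N` is represented by the `m`-gonal form with the given list of coefficients. -/
def Represents (m : ℕ) : List ℕ → ℤ → Prop
  | [], N => N = 0
  | c :: a, N => ∃ x : ℤ, Represents m a (N - c * polygonalNumber m x)

theorem exists_polygonalForm_eq_iff (m : ℕ) (a : List ℕ) (N : ℤ) :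
    (∃ x : Fin a.length → ℤ, polygonalForm m a x = N) ↔ Represents m a N := by
  induction a generalizing N with
  | nil => simp [polygonalForm, Represents, eq_comm]
  | cons c a ih =>
    simp only [Represents, ← ih]
    constructor
    · rintro ⟨x, hx⟩
      have h : polygonalForm m (c :: a) x =
          c * polygonalNumber m (x 0) + polygonalForm m a (fun i => x i.succ) :=
        Fin.sum_univ_succ (n := a.length) _
      exact ⟨x 0, fun i => x i.succ, by rw [← hx, h]; ring⟩
    · rintro ⟨t, x, hx⟩
      refine ⟨Fin.cons (α := fun _ : Fin (a.length + 1) => ℤ) t x, ?_⟩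
      have h : polygonalForm m (c :: a) (Fin.cons (α := fun _ : Fin (a.length + 1) => ℤ) t x) =
          c * polygonalNumber m t + polygonalForm m a x :=
        Fin.sum_univ_succ (n := a.length) _
      rw [h, hx]
      ring

theorem mem_representedSet {m : ℕ} {a : List ℕ} {N : ℤ} :
    N ∈ representedSet m a ↔ N ≠ 0 ∧ Represents m a N := by
  simp only [representedSet, Set.mem_ofPred_eq, exists_polygonalForm_eq_iff]

namespace Represents

variable {m : ℕ} {a b : List ℕ} {M N : ℤ}

theorem perm (h : a.Perm b) : Represents m a N → Represents m b N := by
  induction h generalizing N with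
  | nil => exact id
  | cons c _ ih => exact fun ⟨x, hx⟩ => ⟨x, ih hx⟩
  | swap c d l =>
    rintro ⟨x, y, h⟩
    exact ⟨y, x, by rwa [sub_right_comm]⟩
  | trans _ _ ih₁ ih₂ => exact fun h => ih₂ (ih₁ h)

theorem cons_zero {c : ℕ} (h : Represents m a N) : Represents m (c :: a) N :=
  ⟨0, by simpa [polygonalNumber_zero] using h⟩

theorem append (ha : Represents m a M) (hb : Represents m b N) :
    Represents m (a ++ b) (M + N) := by
  induction a generalizing M with
  | nil =>
    have h : M = 0 := ha
    simpa [h] using hb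
  | cons c a ih =>
    obtain ⟨x, hx⟩ := ha
    exact ⟨x, sub_add_eq_add_sub M _ N ▸ ih hx⟩

theorem sublist (h : a.Sublist b) : Represents m a N → Represents m b N := by
  induction h generalizing N with
  | slnil => exact id
  | cons c _ ih => exact fun h => (ih h).cons_zero
  | cons_cons c _ ih => exact fun ⟨x, hx⟩ => ⟨x, ih hx⟩

theorem list_sum (m : ℕ) (a : List ℕ) : Represents m a (a.sum : ℕ) := by
  induction a with
  | nil => simp [Represents]
  | cons c a ih => exact ⟨1, by simpa [polygonalNumber_one] using ih⟩

theorem of_sublist_sum (h : b.Sublist a) (hN : (b.sum : ℤ) = N) : Represents m a N :=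
  hN ▸ (list_sum m b).sublist h

theorem of_mem {c : ℕ} (h : c ∈ a) : Represents m a c :=
  of_sublist_sum (List.singleton_sublist.2 h) (by simp)

/-- With all coefficients at least `n`, a represented number is `0`, a single coefficient,
a sum of two coefficients, or at least `3n`. -/
theorem eq_zero_or_mem_or_le (hm : 8 ≤ m) {n : ℕ} (ha : ∀ c ∈ a, n ≤ c) (h : Represents m a N) :
    N = 0 ∨ (∃ c ∈ a, N = c) ∨
      (∃ c d, [c, d].Sublist a ∧ (c : ℤ) + d = N) ∨ 3 * (n : ℤ) ≤ N := by
  induction a generalizing N with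
  | nil => exact Or.inl h
  | cons c a ih =>
    obtain ⟨x, hx⟩ := h
    have hc : (n : ℤ) ≤ c := by exact_mod_cast ha c (by simp)
    have hn : (0 : ℤ) ≤ n := by positivity
    have hm' : (8 : ℤ) ≤ m := by exact_mod_cast hm
    have ha' : ∀ d ∈ a, n ≤ d := fun d hd => ha d (by simp [hd])
    rcases polygonalNumber_trichotomy (by omega : 4 ≤ m) x with h0 | h0 | h0
    · rw [h0] at hx
      rcases ih ha' hx with h | ⟨d, hd, h⟩ | ⟨d, e, hde, h⟩ | h
      · left; linarith
      · right; left; exact ⟨d, by simp [hd], by linarith⟩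
      · right; right; left; exact ⟨d, e, hde.cons c, by linarith⟩
      · right; right; right; linarith
    · rw [h0] at hx
      rcases ih ha' hx with h | ⟨d, hd, h⟩ | ⟨d, e, hde, h⟩ | h
      · right; left; exact ⟨c, by simp, by linarith⟩
      · right; right; left
        exact ⟨c, d, (List.singleton_sublist.2 hd).cons_cons c, by linarith⟩
      · right; right; right
        have hd : (n : ℤ) ≤ d := by exact_mod_cast ha' d (hde.subset (by simp))
        have he : (n : ℤ) ≤ e := by exact_mod_cast ha' e (hde.subset (by simp))
        linarith
      · right; right; right; linarith
    · right; right; right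
      -- Here `P_m(x) ≥ m - 3 ≥ 5`, so this term alone exceeds the bound.
      have h1 : 3 * (n : ℤ) ≤ c * polygonalNumber m x := by nlinarith
      have h2 : 0 ≤ N - c * polygonalNumber m x := by
        rcases ih ha' hx with h | ⟨d, hd, h⟩ | ⟨d, e, hde, h⟩ | h
        · linarith
        · rw [h]; positivity
        · rw [← h]; positivity
        · linarith
      linarith

end Represents

/-! ### The structure of tight universal forms -/

theorem representedSet_subset_tailSet {m n : ℕ} {a : List ℕ} (hm : 8 ≤ m) (ha : ∀ c ∈ a, n ≤ c) :
    representedSet m a ⊆ tailSet n := by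
  intro N hN
  obtain ⟨h0, hN⟩ := mem_representedSet.1 hN
  have hn : (0 : ℤ) ≤ n := by positivity
  show (n : ℤ) ≤ N
  rcases hN.eq_zero_or_mem_or_le hm ha with h | ⟨c, hc, h⟩ | ⟨c, d, hcd, h⟩ | h
  · exact absurd h h0
  · have := ha c hc; omega
  · have := ha c (hcd.subset (by simp)); omega
  · omega

theorem le_of_representedSet_eq {m n : ℕ} {a : List ℕ} (hpos : ∀ c ∈ a, 0 < c)
    (h : representedSet m a = tailSet n) {c : ℕ} (hc : c ∈ a) : n ≤ c := by
  have : (c : ℤ) ∈ representedSet m a :=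
    mem_representedSet.2 ⟨by have := hpos c hc; omega, Represents.of_mem hc⟩
  rw [h] at this
  have h' : (n : ℤ) ≤ c := this
  exact_mod_cast h'

theorem mem_xVec_ge {n c : ℕ} (h : c ∈ xVec n) : n ≤ c := by
  simp only [xVec, List.mem_cons, List.mem_range'_1] at h
  omega

theorem mem_yVec_ge {n c : ℕ} (h : c ∈ yVec n) : n ≤ c := by
  simp only [yVec, List.mem_range'_1] at h
  omega

/-- A tight `T(n)`-universal form contains `x_n` or `y_n`. -/
theorem IsTightUniversal.xVec_or_yVec_subperm {m n : ℕ} {a : List ℕ} (hm : 8 ≤ m) (hn : 0 < n)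
    (h : IsTightUniversal m n a) : (xVec n).Subperm a ∨ (yVec n).Subperm a := by
  obtain ⟨hpos, hrep⟩ := h
  have hge : ∀ c ∈ a, n ≤ c := fun c hc => le_of_representedSet_eq hpos hrep hc
  have key : ∀ N : ℤ, (n : ℤ) ≤ N → Represents m a N := fun N hN =>
    (mem_representedSet.1 (hrep.symm ▸ hN : N ∈ representedSet m a)).2
  have hmem : ∀ c : ℕ, n ≤ c → c < 2 * n → c ∈ a := by
    intro c h1 h2
    rcases (key c (by exact_mod_cast h1)).eq_zero_or_mem_or_le hm hge with
      h | ⟨d, hd, h⟩ | ⟨d, e, hde, h⟩ | h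
    · omega
    · rwa [show c = d by exact_mod_cast h]
    · have := hge d (hde.subset (by simp))
      have := hge e (hde.subset (by simp))
      omega
    · omega
  have htwo : (∃ c ∈ a, c = 2 * n) ∨ [n, n].Sublist a := by
    rcases (key (2 * n) (by omega)).eq_zero_or_mem_or_le hm hge with
      h | ⟨d, hd, h⟩ | ⟨d, e, hde, h⟩ | h
    · omega
    · exact Or.inl ⟨d, hd, by exact_mod_cast h.symm⟩
    · have h1 := hge d (hde.subset (by simp))
      have h2 := hge e (hde.subset (by simp))
      obtain rfl : d = n := by omega
      obtain rfl : e = d := by omega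
      exact Or.inr hde
    · omega
  rcases htwo with ⟨c, hc, rfl⟩ | htwo
  · right
    -- The entries of `y_n` are distinct, so inclusion as sets is enough; for `x_n` below, the
    -- multiplicity of `n` must be compared too.
    refine List.subperm_of_subset List.nodup_range' fun d hd => ?_
    simp only [yVec, List.mem_range'_1] at hd
    rcases (show d = 2 * n ∨ d < 2 * n by omega) with rfl | h
    · exact hc
    · exact hmem d hd.1 h
  · left
    rw [List.subperm_ext_iff]
    intro d hd
    rcases eq_or_ne d n with rfl | hdn
    · have h1 : (List.range' d d).count d ≤ 1 := List.nodup_iff_count_le_one.1 List.nodup_range' d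
      have h2 : [d, d].count d ≤ a.count d := htwo.count_le d
      simp only [xVec, List.count_cons_self] at h2 ⊢
      simp at h2
      omega
    · have h1 : (List.range' n n).count d ≤ 1 := List.nodup_iff_count_le_one.1 List.nodup_range' d
      have h2 : 0 < a.count d := by
        rw [List.count_pos_iff]
        simp only [xVec, List.mem_cons, List.mem_range'_1] at hd
        exact hmem d (by omega) (by omega)
      rw [xVec, List.count_cons_of_ne (Ne.symm hdn)]
      omega

/-! ### The quaternary form `∑ xᵢ² + 2 (∑ xᵢ)²` and nine consecutive coefficients -/

theorem exists_sq_eq_and_emod_three (a : ℤ) :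
    ∃ b : ℤ, b ^ 2 = a ^ 2 ∧ ∃ t, b = 3 * t ∨ b = 3 * t + 1 := by
  rcases (show a % 3 = 0 ∨ a % 3 = 1 ∨ a % 3 = 2 by omega) with h | h | h
  · exact ⟨a, rfl, a / 3, by omega⟩
  · exact ⟨a, rfl, a / 3, by omega⟩
  · exact ⟨-a, by ring, (-a) / 3, by omega⟩

/-- If four squares sum to `k` and their roots sum to `3t`, subtracting `t` from each root gives
squares summing to `k - 2t²` and roots summing to `-t`, so the form takes the value `k`. -/
theorem exists_sum_sq_add_two_mul_sq_sum {k : ℕ} (hk : k % 3 ≠ 1) :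
    ∃ x y z w : ℤ, x ^ 2 + y ^ 2 + z ^ 2 + w ^ 2 + 2 * (x + y + z + w) ^ 2 = k := by
  suffices h : ∃ x y z w t : ℤ, x ^ 2 + y ^ 2 + z ^ 2 + w ^ 2 = k ∧ x + y + z + w = 3 * t by
    obtain ⟨x, y, z, w, t, h1, h2⟩ := h
    refine ⟨x - t, y - t, z - t, w - t, ?_⟩
    obtain rfl : w = 3 * t - x - y - z := by linarith
    rw [← h1]
    ring
  obtain ⟨a, b, c, d, h⟩ := Nat.sum_four_squares k
  have h' : (a : ℤ) ^ 2 + (b : ℤ) ^ 2 + (c : ℤ) ^ 2 + (d : ℤ) ^ 2 = k := by exact_mod_cast h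
  obtain ⟨x, hx, p, hp⟩ := exists_sq_eq_and_emod_three a
  obtain ⟨y, hy, q, hq⟩ := exists_sq_eq_and_emod_three b
  obtain ⟨z, hz, r, hr⟩ := exists_sq_eq_and_emod_three c
  obtain ⟨w, hw, s, hs⟩ := exists_sq_eq_and_emod_three d
  rw [← hx, ← hy, ← hz, ← hw] at h'
  have h3 : ∀ u t : ℤ, u = 3 * t ∨ u = 3 * t + 1 →
      (∃ t', u ^ 2 = 3 * t' ∧ u = 3 * t) ∨ (∃ t', u ^ 2 = 3 * t' + 1 ∧ u = 3 * t + 1) := by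
    rintro u t (rfl | rfl)
    · exact Or.inl ⟨3 * t ^ 2, by ring, rfl⟩
    · exact Or.inr ⟨3 * t ^ 2 + 2 * t, by ring, rfl⟩
  -- With roots normalised to 0 or 1 mod 3, the number of 1s is congruent to `k`, hence 0, 2 or 3.
  -- Only for 2 does the sum fail to vanish mod 3, and flipping the sign of one of them repairs it.
  rcases h3 x p hp with ⟨x', hx', hx⟩ | ⟨x', hx', hx⟩ <;>
  rcases h3 y q hq with ⟨y', hy', hy⟩ | ⟨y', hy', hy⟩ <;>
  rcases h3 z r hr with ⟨z', hz', hz⟩ | ⟨z', hz', hz⟩ <;>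
  rcases h3 w s hs with ⟨w', hw', hw⟩ | ⟨w', hw', hw⟩ <;>
  first
  | exact absurd h' (by omega)
  | exact ⟨x, y, z, w, (x + y + z + w) / 3, h', by omega⟩
  | exact ⟨-x, y, z, w, (-x + y + z + w) / 3, by rw [neg_sq]; exact h', by omega⟩
  | exact ⟨x, -y, z, w, (x + -y + z + w) / 3, by rw [neg_sq]; exact h', by omega⟩
  | exact ⟨x, y, -z, w, (x + y + -z + w) / 3, by rw [neg_sq]; exact h', by omega⟩

theorem represents_nine_consecutive (m n : ℕ) {k : ℕ} (hk : k % 3 ≠ 1) :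
    Represents m (List.range' n 9) (((m : ℤ) - 2) * (n + 4) * k) := by
  obtain ⟨x, y, z, w, h⟩ := exists_sum_sq_add_two_mul_sq_sum hk
  simp only [List.range', Represents]
  -- Mirror coefficients add to `2(n + 4)`, and the middle entry is chosen to make the weighted sum
  -- of the variables zero.
  refine ⟨x, y, z, w, -2 * (x + y + z + w), w, z, y, x, ?_⟩
  have hx := two_mul_polygonalNumber m x
  have hy := two_mul_polygonalNumber m y
  have hz := two_mul_polygonalNumber m z
  have hw := two_mul_polygonalNumber m w
  have hs := two_mul_polygonalNumber m (-2 * (x + y + z + w))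
  rw [← h]
  have h2 : ∀ t : ℤ, 2 * t = 0 → t = 0 := fun t ht => by linarith
  apply h2
  push_cast
  linear_combination (-2 * (n + 4 : ℤ)) * (hx + hy + hz + hw) - (n + 4 : ℤ) * hs

/-- It suffices to cover a window of length `3 (m - 2) (n + 4)`. -/
theorem represents_of_window {m n e n₀ : ℕ} (hn : 9 ≤ n) (hm : 3 ≤ m)
    (h : ∀ r : ℕ, n₀ ≤ r → r < n₀ + 3 * ((m - 2) * (n + 4)) → ∃ k : ℕ, k % 3 ≠ 1 ∧
      Represents m (e :: List.range' (n + 9) (n - 9)) ((r : ℤ) - (((m - 2) * (n + 4) * k : ℕ) : ℤ)))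
    {N : ℕ} (hN : n₀ ≤ N) : Represents m (e :: List.range' n n) N := by
  set G := (m - 2) * (n + 4) with hG
  have hGpos : 0 < G := Nat.mul_pos (by omega) (by omega)
  obtain ⟨k, hk, hr⟩ := h (n₀ + (N - n₀) % (3 * G)) (by omega)
    (by have := Nat.mod_lt (N - n₀) (show 0 < 3 * G by omega); omega)
  have hdiv := Nat.div_add_mod (N - n₀) (3 * G)
  set q := (N - n₀) / (3 * G)
  -- Adding `3q` to `k` preserves its class mod 3 and moves the window representation by `3Gq`.
  have h9 := represents_nine_consecutive m n (k := k + 3 * q) (by omega)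
  have hlist : (e :: List.range' n n).Perm
      (List.range' n 9 ++ e :: List.range' (n + 9) (n - 9)) := by
    have : List.range' n n = List.range' n 9 ++ List.range' (n + 9) (n - 9) := by
      rw [List.range'_append_1]; congr 1; omega
    rw [this]
    exact List.perm_middle.symm
  have := (h9.append hr).perm hlist.symm
  convert this using 1
  have hNz : (N : ℤ) = n₀ + (3 * G * q + ((N - n₀) % (3 * G) : ℕ)) := by
    have : N = n₀ + (3 * G * q + (N - n₀) % (3 * G)) := by omega
    exact_mod_cast this
  have hGz : (G : ℤ) = ((m : ℤ) - 2) * (n + 4) := by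
    rw [hG]; push_cast [Nat.cast_sub (show 2 ≤ m by omega)]; ring
  rw [hNz]
  push_cast
  rw [← hGz]
  ring

/-! ### Subset sums of consecutive integers -/

/-- The sums of `j` elements of `{c, …, c + k - 1}` fill an interval. -/
theorem exists_sublist_range'_sum (c k j s : ℕ) (hj : j ≤ k)
    (h₁ : 2 * j * c + j * (j - 1) ≤ 2 * s)
    (h₂ : 2 * s + j * (j + 1) ≤ 2 * j * c + 2 * j * k) :
    ∃ l : List ℕ, l.Sublist (List.range' c k) ∧ l.sum = s := by
  induction k generalizing j s with
  | zero =>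
    obtain rfl : j = 0 := by omega
    exact ⟨[], by simp, by simp; omega⟩
  | succ k ih =>
    rcases j with _ | j
    · exact ⟨[], by simp, by simp at h₂ ⊢; omega⟩
    simp only [Nat.add_sub_cancel] at h₁
    -- Omit the largest element `c + k` if `s` is still within reach; otherwise use it, `hlow`
    -- showing that the remainder is not too small for `j` elements.
    by_cases h : j + 1 ≤ k ∧ 2 * s + (j + 1) * (j + 1 + 1) ≤ 2 * (j + 1) * c + 2 * (j + 1) * k
    · obtain ⟨l, hl, hs⟩ := ih (j + 1) s h.1 (by simpa using h₁) h.2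
      refine ⟨l, hl.trans ?_, hs⟩
      rw [List.range'_concat]
      exact List.sublist_append_left _ _
    · have hjk : j ≤ k := by omega
      have hlow : 2 * j * c + j * (j - 1) + 2 * (c + k) ≤ 2 * s := by
        rcases j with _ | i
        · rcases Nat.eq_zero_or_pos k with rfl | hk
          · simp at h₁ ⊢; omega
          · have := not_and.1 h (by omega)
            simp at this ⊢; omega
        · simp only [Nat.add_sub_cancel]
          rcases (show i + 1 = k ∨ i + 2 ≤ k by omega) with rfl | hk
          · nlinarith
          · have := not_and.1 h (by omega)
            push Not at this
            obtain ⟨d, rfl⟩ := Nat.exists_eq_add_of_le hk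
            -- Both sides of the failed bound are even; halving turns strictness into a gain of a
            -- full unit.
            obtain ⟨t, ht⟩ := Nat.even_mul_succ_self (i + 2)
            have : (i + 2) * c + (i + 2) * (i + 2 + d) + 1 ≤ s + t := by
              by_contra! hlt
              nlinarith
            nlinarith [Nat.zero_le (i * d)]
      obtain ⟨s', rfl⟩ := Nat.exists_eq_add_of_le (show c + k ≤ s by
        have := Nat.zero_le (2 * j * c + j * (j - 1)); omega)
      obtain ⟨l, hl, hs⟩ := ih j s' hjk (by omega) (by nlinarith)
      refine ⟨l ++ [c + k], ?_, by simp [hs]; omega⟩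
      rw [List.range'_concat]
      simpa using hl.append (List.Sublist.refl [c + k])

/-- Subset sums of `k` consecutive integers from `c` cover everything from `2c + 1` up to the
complementary bound. -/
theorem exists_sublist_range'_sum_of_le (c k s : ℕ) (hk : 4 ≤ k) (hc : c + 5 ≤ 2 * k)
    (h₁ : 2 * c + 1 ≤ s) (h₂ : 2 * s + 4 * c + 2 ≤ 2 * k * c + k * (k - 1)) :
    ∃ l : List ℕ, l.Sublist (List.range' c k) ∧ l.sum = s := by
  -- The sums of `j = i + 2` elements form an interval, for `2 ≤ j ≤ k - 2`. Consecutive intervals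
  -- leave no gap when `c ≤ j(k - 1 - j) + 1`; the worst cases `j = 2` and `j = k - 3` give exactly
  -- `c + 5 ≤ 2k`.
  have key : ∀ i : ℕ, i + 4 ≤ k →
      2 * s + (i + 2) * (i + 3) ≤ 2 * (i + 2) * c + 2 * (i + 2) * k →
      ∃ l : List ℕ, l.Sublist (List.range' c k) ∧ l.sum = s := by
    intro i
    induction i with
    | zero =>
      intro _ h
      exact exists_sublist_range'_sum c k 2 s (by omega) (by omega) (by omega)
    | succ i ih =>
      intro hi h
      by_cases h' : 2 * s + (i + 2) * (i + 3) ≤ 2 * (i + 2) * c + 2 * (i + 2) * k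
      · exact ih (by omega) h'
      · refine exists_sublist_range'_sum c k (i + 3) s (by omega) ?_ (by nlinarith)
        simp only [show i + 3 - 1 = i + 2 by omega]
        push Not at h'
        obtain ⟨d, rfl⟩ := Nat.exists_eq_add_of_le hi
        obtain ⟨t, ht⟩ := Nat.even_mul_succ_self (i + 2)
        have : (i + 2) * c + (i + 2) * (i + 1 + 4 + d) + 1 ≤ s + t := by
          by_contra! hlt
          nlinarith
        nlinarith
  obtain ⟨d, rfl⟩ := Nat.exists_eq_add_of_le hk
  refine key d (by omega) ?_
  simp only [show 4 + d - 1 = d + 3 by omega] at h₂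
  nlinarith

/-- For large `n`, subset sums of the remaining coefficients cover the window. -/
theorem represents_of_large {m n e : ℕ} (hm : 8 ≤ m) (hn : 2 * m ≤ n + 5) (hn' : 41 ≤ n)
    (he : e = n ∨ e = 2 * n) {N : ℕ} (hN : n ≤ N) : Represents m (e :: List.range' n n) N := by
  rcases lt_or_ge N (2 * n + 19) with h | h
  · rcases lt_trichotomy N (2 * n) with h' | rfl | h'
    · exact Represents.of_mem (by simp [List.mem_range'_1]; omega)
    · rcases he with rfl | rfl
      · refine Represents.of_sublist_sum (b := [e, e]) ?_ (by simp; ring)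
        exact (List.singleton_sublist.2 (by simp [List.mem_range'_1]; omega)).cons_cons e
      · exact Represents.of_mem (by simp)
    · obtain ⟨l, hl, hs⟩ := exists_sublist_range'_sum_of_le n n N (by omega) (by omega) (by omega)
        (by obtain ⟨d, rfl⟩ := Nat.exists_eq_add_of_le hn'
            simp only [show 41 + d - 1 = d + 40 by omega]
            nlinarith)
      exact Represents.of_sublist_sum (hl.cons e) (by rw [hs])
  -- `2n + 19 = (n + 9) + (n + 10)` is the least sum of two coefficients left after removing the
  -- nine. Since `k = 1` is not available, subset sums must cover a length `2G`; the last third of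
  -- the window then uses `k = 2`.
  · refine represents_of_window (n₀ := 2 * n + 19) (by omega) (by omega) ?_ h
    intro r hr₁ hr₂
    set G := (m - 2) * (n + 4) with hG
    have hGn : 2 * G ≤ (n + 1) * (n + 4) := by
      rw [hG, ← mul_assoc]
      exact Nat.mul_le_mul_right _ (by omega)
    have key : ∀ s : ℕ, 2 * n + 19 ≤ s → s < 2 * n + 19 + 2 * G →
        Represents m (e :: List.range' (n + 9) (n - 9)) s := by
      intro s h₁ h₂
      -- With `2G ≤ (n + 1)(n + 4)`, the upper bound reduces to `n² - 37n - 154 ≥ 0`, which first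
      -- holds at `n = 41`.
      obtain ⟨l, hl, hs⟩ := exists_sublist_range'_sum_of_le (n + 9) (n - 9) s (by omega) (by omega)
        (by omega)
        (by obtain ⟨d, rfl⟩ := Nat.exists_eq_add_of_le hn'
            simp only [show 41 + d - 9 = d + 32 by omega, show d + 32 - 1 = d + 31 by omega]
            nlinarith)
      exact Represents.of_sublist_sum (hl.cons e) (by rw [hs])
    by_cases hr : r < 2 * n + 19 + 2 * G
    · exact ⟨0, by norm_num, by simpa using key r hr₁ hr⟩
    · refine ⟨2, by norm_num, ?_⟩
      convert key (r - 2 * G) (by omega) (by omega) using 1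
      push_cast [Nat.cast_sub (show 2 * G ≤ r by omega)]
      ring

/-! ### Sumsets as bit masks -/

/-- The union of the translates of the set with bit mask `b` by `c * v` for `v` in a list. -/
def orShift (vals : List ℕ) (c b : ℕ) : ℕ :=
  vals.foldr (fun v acc => (b <<< (c * v)) ||| acc) 0

theorem testBit_orShift {vals : List ℕ} {c b i : ℕ} (h : (orShift vals c b).testBit i = true) :
    ∃ v ∈ vals, c * v ≤ i ∧ b.testBit (i - c * v) = true := by
  induction vals with
  | nil => simp [orShift] at h
  | cons v vals ih =>
    have h' : ((b <<< (c * v)) ||| orShift vals c b).testBit i = true := h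
    rw [Nat.testBit_or, Nat.testBit_shiftLeft, Bool.or_eq_true, Bool.and_eq_true,
      decide_eq_true_eq] at h'
    rcases h' with h' | h'
    · exact ⟨v, by simp, h'⟩
    · obtain ⟨w, hw, h'⟩ := ih h'
      exact ⟨w, by simp [hw], h'⟩

/-- A bit mask below `2 ^ B` of sums `∑ c * v` with `c` in the list `a` and `v` in `vals`. -/
def sumMask (B : ℕ) (vals : List ℕ) : List ℕ → ℕ
  | [] => 1
  | c :: a => orShift vals c (sumMask B vals a) % 2 ^ B

/-- Only soundness is needed: truncating at `B` and restricting to `vals` can lose sums but never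
create them. -/
theorem represents_of_testBit_sumMask {m B : ℕ} {vals a : List ℕ}
    (hvals : ∀ v ∈ vals, ∃ x, polygonalNumber m x = v) {i : ℕ}
    (h : (sumMask B vals a).testBit i = true) : Represents m a i := by
  induction a generalizing i with
  | nil =>
    rcases Nat.eq_zero_or_pos i with rfl | hi
    · rfl
    · simp [sumMask, Nat.testBit_one_eq_true_iff_self_eq_zero, hi.ne'] at h
  | cons c a ih =>
    rw [sumMask, Nat.testBit_mod_two_pow, Bool.and_eq_true] at h
    obtain ⟨v, hv, hle, hbit⟩ := testBit_orShift h.2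
    obtain ⟨x, hx⟩ := hvals v hv
    refine ⟨x, ?_⟩
    have := ih hbit
    rw [Nat.cast_sub hle] at this
    rw [hx]
    exact_mod_cast this

/-- The bits `s, …, s + L - 1` of `b` are all set. -/
def allBits (b s L : ℕ) : Bool := (b >>> s) % 2 ^ L == 2 ^ L - 1

theorem testBit_of_allBits {b s L i : ℕ} (h : allBits b s L = true) (h₁ : s ≤ i) (h₂ : i < s + L) :
    b.testBit i = true := by
  rw [allBits, beq_iff_eq] at h
  have h' := congrArg (fun t => t.testBit (i - s)) h
  simp only [Nat.testBit_mod_two_pow, Nat.testBit_two_pow_sub_one, Nat.testBit_shiftRight] at h'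
  rw [show s + (i - s) = i by omega, decide_eq_true (show i - s < L by omega)] at h'
  simpa using h'

/-- The values of the polygonal numbers at `-R, …, R`. -/
def polygonalValues (m R : ℕ) : List ℕ :=
  0 :: (List.range R).flatMap fun j =>
    [(m - 2) * ((j + 1) * j / 2) + (j + 1), (m - 2) * ((j + 1 + 1) * (j + 1) / 2) - (j + 1)]

theorem exists_polygonalNumber_eq {m R v : ℕ} (hm : 4 ≤ m) (hv : v ∈ polygonalValues m R) :
    ∃ x, polygonalNumber m x = v := by
  simp only [polygonalValues, List.mem_cons, List.mem_flatMap, List.not_mem_nil, or_false] at hv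
  have hmz : ((m - 2 : ℕ) : ℤ) = (m : ℤ) - 2 := by omega
  have tri : ∀ j : ℕ, 2 * (((j + 1) * j / 2 : ℕ) : ℤ) = (j + 1) * j := by
    intro j
    have : 2 * ((j + 1) * j / 2) = (j + 1) * j :=
      Nat.mul_div_cancel' (by rw [mul_comm]; exact (Nat.even_mul_succ_self j).two_dvd)
    exact_mod_cast this
  rcases hv with rfl | ⟨j, -, rfl | rfl⟩
  · exact ⟨0, by simp [polygonalNumber_zero]⟩
  · refine ⟨j + 1, ?_⟩
    have h := two_mul_polygonalNumber m (j + 1)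
    have ht := tri j
    apply mul_left_cancel₀ (two_ne_zero (α := ℤ))
    rw [h, Nat.cast_add, Nat.cast_mul, hmz]
    push_cast at ht ⊢
    linear_combination (2 - (m : ℤ)) * ht
  · refine ⟨-(j + 1), ?_⟩
    have h := two_mul_polygonalNumber m (-(j + 1))
    have ht := tri (j + 1)
    have hle : j + 1 ≤ (m - 2) * ((j + 1 + 1) * (j + 1) / 2) := by
      have h₁ : j + 1 ≤ (j + 1 + 1) * (j + 1) / 2 := by
        rw [Nat.le_div_iff_mul_le two_pos]; nlinarith
      exact h₁.trans (Nat.le_mul_of_pos_left _ (by omega))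
    apply mul_left_cancel₀ (two_ne_zero (α := ℤ))
    rw [h, Nat.cast_sub hle, Nat.cast_mul, hmz]
    push_cast at ht ⊢
    linear_combination (2 - (m : ℤ)) * ht

/-- The full form covers `[n, n₀)`, and `[n₀, n₀ + 3 (m - 2) (n + 4))` is covered by the sum of
the form without its nine consecutive coefficients and the values of the latter. -/
def coverCheck (R n₀ m n e : ℕ) : Bool :=
  allBits (sumMask n₀ (polygonalValues m R) (e :: List.range' n n)) n (n₀ - n) &&
  allBits (orShift ((List.range 45).filter fun k => k % 3 != 1) ((m - 2) * (n + 4))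
    (sumMask (n₀ + 3 * ((m - 2) * (n + 4))) (polygonalValues m R)
      (e :: List.range' (n + 9) (n - 9)))) n₀ (3 * ((m - 2) * (n + 4)))

theorem represents_of_coverCheck {R n₀ m n e : ℕ} (hm : 4 ≤ m) (hn : 9 ≤ n)
    (h : coverCheck R n₀ m n e = true) {N : ℕ} (hN : n ≤ N) :
    Represents m (e :: List.range' n n) N := by
  rw [coverCheck, Bool.and_eq_true] at h
  have hvals : ∀ v ∈ polygonalValues m R, ∃ x, polygonalNumber m x = v :=
    fun v hv => exists_polygonalNumber_eq hm hv
  rcases lt_or_ge N n₀ with hlt | hge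
  · exact represents_of_testBit_sumMask hvals (testBit_of_allBits h.1 hN (by omega))
  · refine represents_of_window hn (by omega) ?_ hge
    intro r hr₁ hr₂
    obtain ⟨k, hk, hle, hbit⟩ := testBit_orShift (testBit_of_allBits h.2 hr₁ hr₂)
    refine ⟨k, by simpa using (List.mem_filter.1 hk).2, ?_⟩
    have := represents_of_testBit_sumMask hvals hbit
    rwa [Nat.cast_sub hle] at this

/-- For `n = 11` only `e, 20, 21` remain beside the nine coefficients, so this case gets more
polygonal values and a later window. -/
theorem coverCheck_eleven :
    coverCheck 7 4000 8 11 11 = true ∧ coverCheck 7 4000 8 11 22 = true := by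
  decide +kernel

theorem coverCheck_of_mem : ∀ n ∈ List.range' 12 29, ∀ m ∈ List.range' 8 15, 2 * m ≤ n + 5 →
    coverCheck 4 1000 m n n = true ∧ coverCheck 4 1000 m n (2 * n) = true := by
  decide +kernel

theorem represents_of_le {m n e : ℕ} (hm : 8 ≤ m) (hn : 2 * m ≤ n + 5)
    (he : e = n ∨ e = 2 * n) {N : ℤ} (hN : (n : ℤ) ≤ N) :
    Represents m (e :: List.range' n n) N := by
  lift N to ℕ using (by omega)
  have hN' : n ≤ N := by exact_mod_cast hN
  rcases lt_or_ge n 41 with h | h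
  · rcases (show n = 11 ∨ 12 ≤ n by omega) with rfl | h12
    · obtain rfl : m = 8 := by omega
      rcases he with rfl | rfl
      · exact represents_of_coverCheck (by norm_num) (by norm_num) coverCheck_eleven.1 hN'
      · exact represents_of_coverCheck (by norm_num) (by norm_num) coverCheck_eleven.2 hN'
    · have hc := coverCheck_of_mem n (by rw [List.mem_range'_1]; omega) m
        (by rw [List.mem_range'_1]; omega) hn
      rcases he with rfl | rfl
      · exact represents_of_coverCheck (by omega) (by omega) hc.1 hN'
      · exact represents_of_coverCheck (by omega) (by omega) hc.2 hN'
  · exact represents_of_large hm hn h he hN'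

/-! ### Classification -/

theorem yVec_perm (n : ℕ) : (2 * n :: List.range' n n).Perm (yVec n) := by
  rw [yVec, List.range'_concat, two_mul, one_mul]
  exact (List.perm_append_singleton _ _).symm

theorem isTightUniversal_of_perm {m n : ℕ} (hm : 8 ≤ m) (hn : 2 * m ≤ n + 5) {a : List ℕ}
    (ha : a.Perm (xVec n) ∨ a.Perm (yVec n)) : IsTightUniversal m n a := by
  have hge : ∀ c ∈ a, n ≤ c := by
    rcases ha with ha | ha
    · exact fun c hc => mem_xVec_ge (ha.subset hc)
    · exact fun c hc => mem_yVec_ge (ha.subset hc)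
  refine ⟨fun c hc => lt_of_lt_of_le (by omega) (hge c hc),
    (representedSet_subset_tailSet hm hge).antisymm fun N hN => ?_⟩
  have hN' : (n : ℤ) ≤ N := hN
  refine mem_representedSet.2 ⟨by omega, ?_⟩
  rcases ha with ha | ha
  · exact (represents_of_le hm hn (Or.inl rfl) hN').perm ha.symm
  · exact (represents_of_le hm hn (Or.inr rfl) hN').perm ((yVec_perm n).trans ha.symm)

/-- A copy of `x_n` or `y_n` inside a tight form is itself tight, so newness forces equality.
Conversely, a tight subsequence of either contains one of the two, hence has full length `n + 1`. -/
theorem isNewTightUniversal_iff {m n : ℕ} (hm : 8 ≤ m) (hn : 2 * m ≤ n + 5) (a : List ℕ) :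
    IsNewTightUniversal m n a ↔ a.Perm (xVec n) ∨ a.Perm (yVec n) := by
  constructor
  · rintro ⟨ht, hnew⟩
    have key : ∀ l : List ℕ, (l = xVec n ∨ l = yVec n) → l.Subperm a → a.Perm l := by
      rintro l hl ⟨b, hb, hba⟩
      have hbt : IsTightUniversal m n b :=
        isTightUniversal_of_perm hm hn (by rcases hl with rfl | rfl <;> simp [hb])
      by_cases h : b = a
      · exact h ▸ hb
      · exact absurd hbt.2 (hnew b hba h).ne
    exact (ht.xVec_or_yVec_subperm hm (by omega)).imp (key _ (Or.inl rfl)) (key _ (Or.inr rfl))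
  · intro ha
    have ht := isTightUniversal_of_perm hm hn ha
    refine ⟨ht, fun b hb hne => ?_⟩
    have hpos : ∀ c ∈ b, 0 < c := fun c hc => ht.1 c (hb.subset hc)
    refine (representedSet_subset_tailSet hm fun c hc =>
      le_of_representedSet_eq ht.1 ht.2 (hb.subset hc)).ssubset_of_ne fun heq => hne ?_
    apply hb.eq_of_length_le
    have hla : a.length = n + 1 := by
      rcases ha with ha | ha <;> simp [ha.length_eq, xVec, yVec]
    rcases IsTightUniversal.xVec_or_yVec_subperm hm (by omega) ⟨hpos, heq⟩ with h | h
    · simpa [hla, xVec] using h.length_le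
    · simpa [hla, yVec] using h.length_le

theorem not_xVec_perm_yVec {n : ℕ} (hn : 0 < n) : ¬ (xVec n).Perm (yVec n) := by
  intro h
  have : 2 * n ∈ xVec n := h.symm.subset (by simp [yVec, List.mem_range'_1]; omega)
  simp only [xVec, List.mem_cons, List.mem_range'_1] at this
  omega

theorem mainTheorem8 (m n : ℕ) (hm : 8 ≤ m) (hn : 2 * m ≤ n + 5) :
    (∀ a : List ℕ, IsNewTightUniversal m n a ↔ a.Perm (xVec n) ∨ a.Perm (yVec n)) ∧
    {s : Multiset ℕ | ∃ a : List ℕ, IsNewTightUniversal m n a ∧ (a : Multiset ℕ) = s}.ncard = 2 := by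
  refine ⟨isNewTightUniversal_iff hm hn, ?_⟩
  have hset : {s : Multiset ℕ | ∃ a : List ℕ, IsNewTightUniversal m n a ∧ (a : Multiset ℕ) = s} =
      {(xVec n : Multiset ℕ), (yVec n : Multiset ℕ)} := by
    ext s
    simp only [Set.mem_ofPred_eq, isNewTightUniversal_iff hm hn, Set.mem_insert_iff,
      Set.mem_singleton_iff]
    constructor
    · rintro ⟨a, ha, rfl⟩
      exact ha.imp Multiset.coe_eq_coe.2 Multiset.coe_eq_coe.2
    · rintro (rfl | rfl)
      · exact ⟨_, Or.inl (List.Perm.refl _), rfl⟩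
      · exact ⟨_, Or.inr (List.Perm.refl _), rfl⟩
  rw [hset, Set.ncard_pair]
  exact fun h => not_xVec_perm_yVec (by omega) (Multiset.coe_eq_coe.1 h)
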